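/- A Markov decision process (MDP) $\mathcal M=(S,\mathit{Act},P,\mathsf{init})$ consists of finite sets $S$ of states and $\mathit{Act}$ of actions, an initial state $\mathsf{init}\in S$ and a function $P:S\times\mathit{Act}\times S\to[0,1]$ with $\sum_{t\in S}P(s,\alpha,t)\in\{0,1\}$ for all $s\in S$, $\alpha\in\mathit{Act}$. Let $\mathit{Act}(s)=\{\alpha : \sum_{t}P(s,\alpha,t)=1\}$ be the set of actions enabled in $s$; $s$ is terminal if $\mathit{Act}(s)=\varnothing$. A memoryless randomized (MR) scheduler assigns to each non-terminal state $s$ a probability distribution on $\mathit{Act}(s)$; it induces a probability measure on the maximal paths starting in $\mathsf{init}$, that is, paths that are infinite or end in a terminal state. The expected frequency of a state-action pair $(s,\alpha)$ is the expected number (in $[0,\infty]$) of visits to $s$ in which $\alpha$ is taken, and the expected frequency of an action $\alpha$ is the sum over all states $s$ of the expected frequencies of $(s,\alpha)$. An end component is a strongly connected sub-MDP with at least one state-action pair, identified with its set of state-action pairs; a maximal end component (MEC) is one that is maximal with respect to inclusion. Assume that $\mathit{Act}(s)\cap\mathit{Act}(t)=\varnothing$ for all states $s\neq t$ of $\mathcal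 M$. Let $U$ be the set of states that belong to a MEC. The MEC-quotient $\mathcal N$ of $\mathcal M$ is the MDP with state space $(S\setminus U)\cup\{s_{\mathcal E}:\mathcal E\text{ a MEC of }\mathcal M\}\cup\{\bot\}$, where the $s_{\mathcal E}$ and $\bot$ are pairwise distinct fresh states, and action set $\mathit{Act}\cup\{\tau\}$ with $\tau$ fresh. Let $\iota(s)=s$ for $s\in S\setminus U$ and $\iota(u)=s_{\mathcal E}$ if $u$ is a state of the MEC $\mathcal E$; the initial state of $\mathcal N$ is $\iota(\mathsf{init})$. In $s\in S\setminus U$ the enabled actions are those in $\mathit{Act}(s)$, with $P_{\mathcal N}(s,\alpha,s')=P(s,\alpha,\iota^{-1}(s'))$. In $s_{\mathcal E}$ the enabled actions are $\tau$, with $P_{\mathcal N}(s_{\mathcal E},\tau,\bot)=1$, and all $\alpha\in\mathit{Act}(u)$ with $u$ a state of $\mathcal E$ and $(u,\alpha)\notin\mathcal E$, with $P_{\mathcal N}(s_{\mathcal E},\alpha,s')=P(u,\alpha,\iota^{-1}(s'))$. The state $\bot$ is terminal. **Theorem.** Let $\mathcal M$ be an MDP with pairwise disjoint sets of enabled actions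 for distinct states, let $\mathcal N$ be its MEC-quotient, and let $\mathfrak S$ be an MR-scheduler for $\mathcal N$ with $\mathfrak S(s_{\mathcal E})(\tau)\in\{0,1\}$ for each MEC $\mathcal E$ of $\mathcal M$. Then there is an MR-scheduler $\mathfrak T$ for $\mathcal M$ such that every action $\alpha\in\mathit{Act}$ that does not belong to a MEC of $\mathcal M$ has the same expected frequency in $\mathcal N$ under $\mathfrak S$ as in $\mathcal M$ under $\mathfrak T$. -/

import Mathlib

open scoped NNReal ENNReal

universe u v

/-- A (finite) Markov decision process with state space `S` and action set `Act`. The values of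
`P` are automatically at most `1`. -/
structure MDP (S : Type u) (Act : Type v) [Fintype S] where
  /-- the transition probability function -/
  P : S → Act → S → ℝ≥0
  /-- the initial state -/
  init : S
  sum_P : ∀ s α, ∑ t, P s α t = 0 ∨ ∑ t, P s α t = 1

namespace MDP

variable {S : Type u} {Act : Type v} [Fintype S]

/-- The set `Act(s)` of actions that are enabled in `s`. -/
def act (M : MDP S Act) (s : S) : Set Act := {α | ∑ t, M.P s α t = 1}

/-- A state without enabled actions. -/
def Terminal (M : MDP S Act) (s : S) : Prop := M.act s = ∅

/-- The sets of enabled actions of distinct states are disjoint. -/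
def DisjointActions (M : MDP S Act) : Prop := Pairwise fun s t => Disjoint (M.act s) (M.act t)

/-! ### Memoryless randomized schedulers, maximal paths, expected frequencies -/

/-- A memoryless randomized scheduler: it assigns to each non-terminal state `s` a distribution
over `Act(s)`. For a terminal state `s`, the condition `supp` forces `prob s = 0`. -/
structure MRScheduler [Fintype Act] (M : MDP S Act) where
  prob : S → Act → ℝ≥0
  supp : ∀ s α, prob s α ≠ 0 → α ∈ M.act s
  sum_prob : ∀ s, ¬ M.Terminal s → ∑ α, prob s α = 1

/-- One position of a maximal path: the current state, and the action that is taken in it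
(`none` iff the state is terminal, so that no action can be taken). -/
def Step (S : Type u) (Act : Type v) : Type (max u v) := S × Option Act

instance : MeasurableSpace (Step S Act) := ⊤

instance : DiscreteMeasurableSpace (Step S Act) := ⟨fun _ => trivial⟩

instance [Finite Act] : Finite (Step S Act) := inferInstanceAs (Finite (S × Option Act))

namespace MRScheduler

variable [Fintype Act] {M : MDP S Act} (𝔖 : M.MRScheduler)

open Classical in
/-- The law of the action taken in `s`; no action (`none`) is taken iff `s` is terminal. -/
noncomputable def actionLaw (s : S) : PMF (Option Act) :=
  PMF.ofFintype (fun o => o.elim (if M.Terminal s then 1 else 0) fun α => (𝔖.prob s α : ℝ≥0∞)) (by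
    rw [Fintype.sum_option]
    simp only [Option.elim_none, Option.elim_some]
    by_cases h : M.Terminal s
    · have h0 : ∀ α, 𝔖.prob s α = 0 := fun α => by
        by_contra hα
        have h1 := 𝔖.supp s α hα
        rw [show M.act s = ∅ from h] at h1
        exact h1
      simp [h, h0]
    · have h1 := 𝔖.sum_prob s h
      simp only [h, if_false, zero_add]
      exact_mod_cast h1)

/-- The law of the position of a path at which the state is `s`. -/
noncomputable def stepAt (s : S) : PMF (Step S Act) :=
  (𝔖.actionLaw s).map fun o => (s, o)

open Classical in
/-- The law of the next position of a path. From `(s, α)` with `α ∈ Act(s)` the path moves to `t`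
with probability `P(s, α, t)`. A finite maximal path, which ends in a terminal state `s`, is
represented by the infinite sequence that repeats `(s, none)` forever. (The remaining case, an
action that is not enabled, has probability zero.) -/
noncomputable def next : Step S Act → PMF (Step S Act)
  | (s, none) => PMF.pure (s, none)
  | (s, some α) =>
    if h : ∑ t, M.P s α t = 1 then
      (PMF.ofFintype (fun t => (M.P s α t : ℝ≥0∞)) (by exact_mod_cast h)).bind 𝔖.stepAt
    else PMF.pure (s, none)

/-- The transition kernel of the Markov chain induced by the scheduler. -/
noncomputable def nextKernel : ProbabilityTheory.Kernel (Step S Act) (Step S Act) :=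
  ProbabilityTheory.Kernel.ofFunOfCountable fun x => (𝔖.next x).toMeasure

instance : ProbabilityTheory.IsMarkovKernel 𝔖.nextKernel :=
  ⟨fun x => inferInstanceAs (MeasureTheory.IsProbabilityMeasure (𝔖.next x).toMeasure)⟩

/-- `nextKernel`, as a kernel from the histories up to time `n` to the position at time `n + 1`. -/
noncomputable def histKernel (n : ℕ) :
    ProbabilityTheory.Kernel ((i : Finset.Iic n) → (fun _ : ℕ => Step S Act) i)
      ((fun _ : ℕ => Step S Act) (n + 1)) :=
  𝔖.nextKernel.comap (fun h => h ⟨n, Finset.mem_Iic.2 le_rfl⟩) (measurable_pi_apply _)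

instance (n : ℕ) : ProbabilityTheory.IsMarkovKernel (𝔖.histKernel n) :=
  ProbabilityTheory.Kernel.IsMarkovKernel.comap _ _

/-- The probability measure on maximal paths from the initial state that is induced by the
scheduler (by the Ionescu-Tulcea theorem). -/
noncomputable def pathMeasure : MeasureTheory.Measure (ℕ → Step S Act) :=
  ProbabilityTheory.Kernel.trajMeasure (X := fun _ => Step S Act) (𝔖.stepAt M.init).toMeasure
    𝔖.histKernel

open Classical in
/-- The number of visits to `s` in which `α` is taken, along the path `ω`. -/
noncomputable def visits (s : S) (α : Act) (ω : ℕ → Step S Act) : ℝ≥0∞ :=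
  ∑' n, if ω n = (s, some α) then 1 else 0

/-- The expected frequency of the state-action pair `(s, α)`. -/
noncomputable def freq (s : S) (α : Act) : ℝ≥0∞ :=
  ∫⁻ ω, visits s α ω ∂𝔖.pathMeasure

/-- The expected frequency of the action `α`. -/
noncomputable def actionFreq (α : Act) : ℝ≥0∞ := ∑ s, 𝔖.freq s α

end MRScheduler

/-! ### End components -/

/-- The states of a sub-MDP that is given by its set of state-action pairs. -/
def statesOf {S : Type u} {Act : Type v} (E : Set (S × Act)) : Set S := {s | ∃ α, (s, α) ∈ E}

/-- An end component, identified with its set of state-action pairs: a strongly connected sub-MDP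
with at least one state-action pair. -/
structure IsEC (M : MDP S Act) (E : Set (S × Act)) : Prop where
  nonempty : E.Nonempty
  enabled : ∀ s α, (s, α) ∈ E → α ∈ M.act s
  closed : ∀ s α t, (s, α) ∈ E → 0 < M.P s α t → t ∈ statesOf E
  connected : ∀ s ∈ statesOf E, ∀ t ∈ statesOf E,
    Relation.ReflTransGen (fun x y => ∃ α, (x, α) ∈ E ∧ 0 < M.P x α y) s t

/-- The maximal end components of `M`. -/
def MEC (M : MDP S Act) : Type (max u v) := {E : Set (S × Act) // Maximal M.IsEC E}

/-- The set of states of a maximal end component. -/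
def MEC.states {M : MDP S Act} (E : M.MEC) : Set S := statesOf E.1

theorem statesOf_union {S : Type u} {Act : Type v} (E F : Set (S × Act)) :
    statesOf (E ∪ F) = statesOf E ∪ statesOf F := by
  ext s
  constructor
  · rintro ⟨α, h | h⟩
    exacts [Or.inl ⟨α, h⟩, Or.inr ⟨α, h⟩]
  · rintro (⟨α, h⟩ | ⟨α, h⟩)
    exacts [⟨α, Or.inl h⟩, ⟨α, Or.inr h⟩]

theorem IsEC.union {M : MDP S Act} {E F : Set (S × Act)} (hE : M.IsEC E) (hF : M.IsEC F)
    {s : S} (hsE : s ∈ statesOf E) (hsF : s ∈ statesOf F) : M.IsEC (E ∪ F) := by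
  refine ⟨hE.nonempty.mono Set.subset_union_left, ?_, ?_, ?_⟩
  · rintro t α (h | h)
    exacts [hE.enabled t α h, hF.enabled t α h]
  · rintro t α r (h | h) hr
    all_goals rw [statesOf_union]
    exacts [Or.inl (hE.closed t α r h hr), Or.inr (hF.closed t α r h hr)]
  · have key : ∀ t ∈ statesOf (E ∪ F),
        Relation.ReflTransGen (fun x y => ∃ α, (x, α) ∈ E ∪ F ∧ 0 < M.P x α y) s t ∧
        Relation.ReflTransGen (fun x y => ∃ α, (x, α) ∈ E ∪ F ∧ 0 < M.P x α y) t s := by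
      intro t ht
      rw [statesOf_union] at ht
      rcases ht with ht | ht
      · exact ⟨Relation.ReflTransGen.mono (fun _ _ ⟨α, h, h'⟩ => ⟨α, Or.inl h, h'⟩) _ _
            (hE.connected s hsE t ht),
          Relation.ReflTransGen.mono (fun _ _ ⟨α, h, h'⟩ => ⟨α, Or.inl h, h'⟩) _ _
            (hE.connected t ht s hsE)⟩
      · exact ⟨Relation.ReflTransGen.mono (fun _ _ ⟨α, h, h'⟩ => ⟨α, Or.inr h, h'⟩) _ _
            (hF.connected s hsF t ht),
          Relation.ReflTransGen.mono (fun _ _ ⟨α, h, h'⟩ => ⟨α, Or.inr h, h'⟩) _ _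
            (hF.connected t ht s hsF)⟩
    exact fun t ht r hr => (key t ht).2.trans (key r hr).1

/-- Maximal end components with a common state are equal. -/
theorem MEC.eq_of_mem {M : MDP S Act} {E F : M.MEC} {s : S} (hE : s ∈ E.states)
    (hF : s ∈ F.states) : E = F := by
  have h := E.2.prop.union F.2.prop hE hF
  exact Subtype.ext (((E.2.eq_of_subset h Set.subset_union_left)).trans
    (F.2.eq_of_subset h Set.subset_union_right).symm)

/-! ### The MEC-quotient -/

/-- The states of the MEC-quotient: the states of `M` in no maximal end component, a state `mec E`
for each maximal end component `E`, and a trap state `bot`. -/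
inductive QState (M : MDP S Act) : Type (max u v)
  | keep (s : S) (h : ∀ E : M.MEC, s ∉ E.states) : QState M
  | mec (E : M.MEC) : QState M
  | bot : QState M

instance [Finite Act] (M : MDP S Act) : Finite M.QState :=
  Finite.of_injective
    (fun x : M.QState => match x with
      | .keep s _ => (some (Sum.inl s) : Option (S ⊕ Set (S × Act)))
      | .mec E => some (Sum.inr E.1)
      | .bot => none)
    (by
      intro x y h
      cases x <;> cases y <;> simp_all
      exact Subtype.ext h)

noncomputable instance [Finite Act] (M : MDP S Act) : Fintype M.QState := Fintype.ofFinite _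

open Classical in
/-- The map `ι` from the states of `M` to the states of its MEC-quotient. -/
noncomputable def toQuot (M : MDP S Act) (s : S) : M.QState :=
  if h : ∃ E : M.MEC, s ∈ E.states then .mec h.choose
  else .keep s fun E hE => h ⟨E, hE⟩

theorem toQuot_of_mem {M : MDP S Act} {E : M.MEC} {s : S} (h : s ∈ E.states) :
    M.toQuot s = .mec E := by
  have h' : ∃ E : M.MEC, s ∈ E.states := ⟨E, h⟩
  rw [toQuot, dif_pos h', MEC.eq_of_mem h'.choose_spec h]

theorem toQuot_of_notMem {M : MDP S Act} {s : S} (h : ∀ E : M.MEC, s ∉ E.states) :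
    M.toQuot s = .keep s h :=
  dif_neg fun ⟨E, hE⟩ => h E hE

/-- The fresh action `τ` of the MEC-quotient, whose action set is `Act ∪ {τ}`. -/
abbrev tau : Option Act := none

open Classical in
/-- `P(s, α, ι⁻¹(x))`. -/
noncomputable def probPreimage (M : MDP S Act) (s : S) (α : Act) (x : M.QState) : ℝ≥0 :=
  ∑ t with M.toQuot t = x, M.P s α t

open Classical in
/-- The transition probabilities of the MEC-quotient. In a state `mec E`, an action `α` of `M` is
enabled iff `α ∈ Act(u)` and `(u, α) ∉ E` for a state `u` of `E`; in an MDP with disjoint action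
sets, this `u` is unique, and the sum below is then `P(u, α, ι⁻¹(x))`. -/
noncomputable def quotP (M : MDP S Act) : M.QState → Option Act → M.QState → ℝ≥0
  | .keep s _, some α, x => M.probPreimage s α x
  | .keep _ _, none, _ => 0
  | .mec E, some α, x => ∑ u with u ∈ E.states ∧ (u, α) ∉ E.1, M.probPreimage u α x
  | .mec _, none, x => if x = .bot then 1 else 0
  | .bot, _, _ => 0

theorem sum_probPreimage [Fintype Act] (M : MDP S Act) (s : S) (α : Act) :
    ∑ x, M.probPreimage s α x = ∑ t, M.P s α t := by
  classical
  simpa [probPreimage] using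
    Finset.sum_fiberwise (s := Finset.univ) (g := M.toQuot) (f := fun t => M.P s α t)

/-- The MEC-quotient of an MDP whose states have pairwise disjoint sets of enabled actions. -/
noncomputable def mecQuotient [Fintype Act] (M : MDP S Act) (hM : M.DisjointActions) :
    MDP M.QState (Option Act) where
  P := M.quotP
  init := M.toQuot M.init
  sum_P := by
    classical
    rintro (⟨s, h⟩ | E | _) (_ | α)
    · simp [quotP]
    · simpa only [quotP, sum_probPreimage] using M.sum_P s α
    · simp [quotP]
    · simp only [quotP]
      rw [Finset.sum_comm]
      simp only [sum_probPreimage]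
      by_cases h : ∃ u, (u ∈ E.states ∧ (u, α) ∉ E.1) ∧ ∑ t, M.P u α t = 1
      · obtain ⟨u, hu, h1⟩ := h
        right
        rw [Finset.sum_eq_single_of_mem u (by simpa using hu), h1]
        intro v _ hv
        refine (M.sum_P v α).resolve_right fun h2 => ?_
        exact Set.disjoint_left.1 (hM hv) h2 h1
      · left
        refine Finset.sum_eq_zero fun u hu => (M.sum_P u α).resolve_right fun h1 => h ⟨u, ?_, h1⟩
        simpa using hu
    · simp [quotP]
    · simp [quotP]

end MDP

namespace MDP
variable {S : Type*} {Act : Type*} [Fintype S]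
open MeasureTheory ProbabilityTheory

/-! Expected frequencies are flows. The state frequencies of a scheduler are the least nonnegative
solution of the balance equations (`stateFreq_eq`, `stateFreq_le`), and a pair has the frequency of
its state times the probability of its action (`freq_eq`). It thus suffices to build a flow in `M`
that agrees with the quotient outside the MECs, and to read `𝔗` off from it.

In the quotient, state frequencies are finite: a set trapping the paths would contain some `mec F`
at which all used actions lie inside `F`, but the actions offered there are exits. Spread over the
states of `M`, these frequencies become `exitFreq` and `entryFreq`. In an active MEC entries and
exits have the same total, so a circulation inside the MEC connects them (`MEC.exists_circulation`);
adding a multiple of a stationary vector makes it positive everywhere. A MEC that is not active has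
no exit flow, because `τ` has probability 0 or 1; there `𝔗` stays forever, which affects nothing
outside.

The flow must still be the least solution (`stateFreq_eq_of_balance`). Otherwise its excess over the
expected frequencies is supported on a closed set without loss of mass. As `𝔗` uses every pair of an
active MEC, `exists_mec_of_closed` finds in that set an active MEC that `𝔗` never leaves, although
its exit flow is positive. -/

/-- The position of a path at which the state is `s` and `o` is done. -/
def Step.mk {S : Type*} {Act : Type*} (s : S) (o : Option Act) : Step S Act := (s, o)

theorem Step.mk_inj {S : Type*} {Act : Type*} {s t : S} {o p : Option Act} (h : Step.mk s o = Step.mk t p) : s = t ∧ o = p :=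
  Prod.ext_iff.1 h

/-! ### Path measure and expected frequencies as solutions of balance equations -/

namespace MRScheduler
variable [Fintype Act] {M : MDP S Act} (𝔖 : M.MRScheduler)

/-- The probability of moving from `s` to `t` in one step. -/
noncomputable def trans (s t : S) : ℝ≥0 := ∑ α, 𝔖.prob s α * M.P s α t

open Classical in
/-- The probability that the `n`-th state exists and is `s`, a path being regarded as dying after
its last action. -/
noncomputable def visitProb : ℕ → S → ℝ≥0∞
  | 0, s => if s = M.init then 1 else 0
  | n + 1, t => ∑ s, visitProb n s * 𝔖.trans s t

/-- The expected frequency of a state. -/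
noncomputable def stateFreq (s : S) : ℝ≥0∞ := ∑' n, 𝔖.visitProb n s

theorem actionLaw_some (s : S) (α : Act) : 𝔖.actionLaw s (some α) = 𝔖.prob s α := by
  simp [actionLaw]

theorem stepAt_some (s t : S) (α : Act) [Decidable (s = t)] :
    𝔖.stepAt s (Step.mk t (some α)) = if s = t then (𝔖.prob s α : ℝ≥0∞) else 0 := by
  classical
  rw [show 𝔖.stepAt s = (𝔖.actionLaw s).map (Step.mk s) from rfl, PMF.map_apply]
  split_ifs with h
  · subst h
    rw [tsum_eq_single (some α)]
    · rw [if_pos rfl, actionLaw_some]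
    · intro o ho
      rw [if_neg]
      intro h
      exact ho (Step.mk_inj h).2.symm
  · rw [ENNReal.tsum_eq_zero]
    intro o
    rw [if_neg]
    intro h'
    exact h (Step.mk_inj h').1.symm

theorem next_none (s t : S) (β : Act) :
    𝔖.next (Step.mk s none) (Step.mk t (some β)) = 0 := by
  classical
  rw [show 𝔖.next (Step.mk s none) = PMF.pure (Step.mk s none) from rfl, PMF.pure_apply, if_neg]
  intro h
  exact absurd (Step.mk_inj h).2 (by simp)

theorem next_some (s t : S) (α β : Act) :
    𝔖.next (Step.mk s (some α)) (Step.mk t (some β))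
      = M.P s α t * 𝔖.prob t β := by
  classical
  have e : 𝔖.next (Step.mk s (some α)) = if h : ∑ t, M.P s α t = 1 then
      (PMF.ofFintype (fun t => (M.P s α t : ℝ≥0∞)) (by exact_mod_cast h)).bind 𝔖.stepAt
      else PMF.pure (Step.mk s none) := rfl
  rw [e]
  split_ifs with h
  · rw [PMF.bind_apply, tsum_fintype, Finset.sum_eq_single t]
    · rw [stepAt_some, if_pos rfl]; rfl
    · intro r _ hr
      rw [stepAt_some, if_neg hr, mul_zero]
    · simp
  -- An action that is not enabled has a zero row, and `next` then stops with `none`: both sides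
  -- vanish.
  · have h0 := (M.sum_P s α).resolve_right h
    rw [Finset.sum_eq_zero_iff] at h0
    rw [h0 t (Finset.mem_univ _), PMF.pure_apply, if_neg]
    · simp
    · intro h
      exact absurd (Step.mk_inj h).2 (by simp)

theorem pathMeasure_zero (x : Step S Act) :
    𝔖.pathMeasure {ω | ω 0 = x} = 𝔖.stepAt M.init x := by
  have hx : MeasurableSet {ω : ℕ → Step S Act | ω 0 = x} :=
    measurableSet_eq_fun (measurable_pi_apply 0) measurable_const
  have e : {ω : ℕ → Step S Act | ω 0 = x} =
      (Preorder.frestrictLe 0) ⁻¹' {h : (i : Finset.Iic 0) → Step S Act | h ⟨0, by simp⟩ = x} := rfl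
  have hx' : MeasurableSet {h : (i : Finset.Iic 0) → Step S Act | h ⟨0, by simp⟩ = x} :=
    measurableSet_eq_fun (measurable_pi_apply _) measurable_const
  rw [pathMeasure, Kernel.trajMeasure, e, ← Measure.map_apply (by fun_prop) hx',
    Measure.map_comp _ _ (by fun_prop), Kernel.traj_map_frestrictLe, Kernel.partialTraj_self,
    Measure.id_comp, Measure.map_apply (by fun_prop) hx']
  rw [← PMF.toMeasure_apply_singleton (𝔖.stepAt M.init) x (MeasurableSet.singleton x)]
  congr 1

theorem pathMeasure_succ (n : ℕ) (x : Step S Act) :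
    𝔖.pathMeasure {ω | ω (n + 1) = x} = ∫⁻ ω, 𝔖.next (ω n) x ∂𝔖.pathMeasure := by
  -- Markov property: the history up to `n`, followed by one step of the kernel, has the joint law
  -- of that history and position `n + 1`.
  have key := Kernel.map_frestrictLe_trajMeasure_compProd_eq_map_trajMeasure
    (X := fun _ => Step S Act) (μ₀ := (𝔖.stepAt M.init).toMeasure) (κ := 𝔖.histKernel) (a := n)
  have hx : MeasurableSet (Prod.snd ⁻¹' {x} :
      Set (((i : Finset.Iic n) → Step S Act) × Step S Act)) :=
    measurable_snd (MeasurableSet.singleton x)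
  have h2 := congrArg (fun μ => μ (Prod.snd ⁻¹' {x})) key
  rw [Measure.map_apply (by fun_prop) hx, Measure.compProd_apply hx, lintegral_map
    (Kernel.measurable_kernel_prodMk_left hx) (by fun_prop)] at h2
  refine h2.symm.trans (lintegral_congr fun ω => ?_)
  exact PMF.toMeasure_apply_singleton (𝔖.next (ω n)) x (MeasurableSet.singleton x)

theorem lintegral_pathMeasure (n : ℕ) (f : Step S Act → ℝ≥0∞) :
    ∫⁻ ω, f (ω n) ∂𝔖.pathMeasure =
      ∑ s, ∑ o : Option Act, f (Step.mk s o) *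
        𝔖.pathMeasure {ω | ω n = (Step.mk s o)} := by
  let _ : Fintype (Step S Act) := inferInstanceAs (Fintype (S × Option Act))
  rw [← lintegral_map (f := f) (g := fun ω : ℕ → Step S Act => ω n) (measurable_of_finite f)
    (measurable_pi_apply n), lintegral_fintype]
  refine (Fintype.sum_prod_type (fun x : S × Option Act => _)).trans ?_
  refine Finset.sum_congr rfl fun s _ => Finset.sum_congr rfl fun o _ => ?_
  exact congrArg (f (Step.mk s o) * ·)
    (Measure.map_apply (measurable_pi_apply n) (MeasurableSet.singleton (Step.mk s o)))

theorem pathMeasure_eq (n : ℕ) (s : S) (α : Act) :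
    𝔖.pathMeasure {ω | ω n = (Step.mk s (some α))} = 𝔖.visitProb n s * 𝔖.prob s α := by
  classical
  induction n generalizing s α with
  | zero =>
    rw [pathMeasure_zero, stepAt_some, visitProb]
    by_cases h : M.init = s
    · subst h; simp
    · rw [if_neg h, if_neg (Ne.symm h), zero_mul]
  | succ n ih =>
    rw [pathMeasure_succ, lintegral_pathMeasure 𝔖 n fun y => 𝔖.next y _, visitProb,
      Finset.sum_mul]
    refine Finset.sum_congr rfl fun r _ => ?_
    rw [Fintype.sum_option, next_none, zero_mul, zero_add, trans, ENNReal.ofNNReal_finsetSum,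
      Finset.mul_sum, Finset.sum_mul]
    refine Finset.sum_congr rfl fun β _ => ?_
    rw [next_some, ih, ENNReal.coe_mul]
    ring

/-- From here on the path measure can be replaced by linear algebra: expectation and sum over time
are exchanged, and the choice of `α` has the same law at every visit to `s`. -/
theorem freq_eq (s : S) (α : Act) : 𝔖.freq s α = 𝔖.stateFreq s * 𝔖.prob s α := by
  classical
  have e : 𝔖.freq s α =
      ∫⁻ ω, ∑' n, (if ω n = Step.mk s (some α) then 1 else 0) ∂𝔖.pathMeasure := by
    unfold freq visits
    congr! with ω n
  rw [e]
  have hm : ∀ n, MeasurableSet {ω : ℕ → Step S Act | ω n = (Step.mk s (some α))} :=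
    fun n => measurableSet_eq_fun (measurable_pi_apply n) measurable_const
  rw [lintegral_tsum, stateFreq, ← ENNReal.tsum_mul_right]
  · refine tsum_congr fun n => ?_
    rw [← pathMeasure_eq, ← lintegral_indicator_one (hm n)]
    refine lintegral_congr fun ω => ?_
    by_cases h : ω n = (Step.mk s (some α))
    · rw [if_pos h, Set.indicator_of_mem (by exact h)]; rfl
    · rw [if_neg h, Set.indicator_of_notMem (by exact h)]
  · intro n
    exact (Measurable.ite (hm n) measurable_const measurable_const).aemeasurable

theorem stateFreq_eq (t : S) [Decidable (t = M.init)] :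
    𝔖.stateFreq t = (if t = M.init then 1 else 0) + ∑ s, 𝔖.stateFreq s * 𝔖.trans s t := by
  rw [stateFreq, tsum_eq_zero_add' ENNReal.summable]
  congr 1
  · simp only [visitProb]
    congr
  · simp only [visitProb, stateFreq, ← ENNReal.tsum_mul_right]
    rw [Summable.tsum_finsetSum fun _ _ => ENNReal.summable]

/-- Partial sums over time stay below every supersolution, by induction. The value `⊤` is allowed,
so that a supersolution can ignore some of the states. -/
theorem stateFreq_le [DecidableEq S] {x : S → ℝ≥0∞}
    (hx : ∀ t, (if t = M.init then 1 else 0) + ∑ s, x s * 𝔖.trans s t ≤ x t) (t : S) :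
    𝔖.stateFreq t ≤ x t := by
  have key : ∀ n t, ∑ i ∈ Finset.range n, 𝔖.visitProb i t ≤ x t := by
    intro n
    induction n with
    | zero => simp
    | succ n ih =>
      intro t
      rw [Finset.sum_range_succ', add_comm]
      refine le_trans (add_le_add (le_of_eq ?_) ?_) (hx t)
      · simp only [visitProb]
        congr
      · simp only [visitProb]
        rw [Finset.sum_comm]
        refine Finset.sum_le_sum fun s _ => ?_
        rw [← Finset.sum_mul]
        gcongr
        exact ih s
  exact ENNReal.tsum_le_of_sum_range_le fun n => key n t

end MRScheduler
end MDP

/-! ### Subinvariant vectors of substochastic matrices -/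

section Substochastic

variable {ι : Type*} [Fintype ι] {Q : ι → ι → ℝ}

/-- The support of a subinvariant vector of a substochastic matrix is closed and loses no mass. -/
theorem support_closed_of_subinvariant (hQ0 : ∀ s t, 0 ≤ Q s t) (hQ1 : ∀ s, ∑ t, Q s t ≤ 1)
    {h : ι → ℝ} (h0 : ∀ s, 0 ≤ h s) (hh : ∀ t, h t ≤ ∑ s, h s * Q s t) {s : ι} (hs : 0 < h s) :
    ∑ t, Q s t = 1 ∧ ∀ t, 0 < Q s t → 0 < h t := by
  have e1 : ∑ t, ∑ s, h s * Q s t = ∑ s, h s * ∑ t, Q s t := by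
    rw [Finset.sum_comm]
    simp only [Finset.mul_sum]
  have l1 : ∑ t, h t ≤ ∑ t, ∑ s, h s * Q s t := Finset.sum_le_sum fun t _ => hh t
  have l2 : ∀ s ∈ Finset.univ, h s * ∑ t, Q s t ≤ h s := fun s _ =>
    mul_le_of_le_one_right (h0 s) (hQ1 s)
  have l3 := Finset.sum_le_sum l2
  -- The inequalities form a chain from `∑ h` back to `∑ h`, so each of them is an equality in every
  -- coordinate.
  have eq1 := (Finset.sum_eq_sum_iff_of_le fun t _ => hh t).1 (by linarith)
  have eq2 := (Finset.sum_eq_sum_iff_of_le l2).1 (by linarith)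
  refine ⟨mul_left_cancel₀ hs.ne' ((eq2 s (Finset.mem_univ s)).trans (mul_one _).symm),
    fun t ht => ?_⟩
  rw [eq1 t (Finset.mem_univ t)]
  exact (mul_pos hs ht).trans_le (Finset.single_le_sum (f := fun s => h s * Q s t)
    (fun s _ => mul_nonneg (h0 s) (hQ0 s t)) (Finset.mem_univ s))

/-- If a substochastic matrix has no closed set without loss of mass, then the balance equation
has a solution for every source term, and the solution is nonnegative if the source is. -/
theorem exists_balance_solution (hQ0 : ∀ s t, 0 ≤ Q s t) (hQ1 : ∀ s, ∑ t, Q s t ≤ 1)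
    (hC : ∀ C : Set ι, C.Nonempty → ¬ ∀ s ∈ C, ∑ t, Q s t = 1 ∧ ∀ t, 0 < Q s t → t ∈ C)
    (b : ι → ℝ) :
    ∃ z : ι → ℝ, (∀ t, z t = b t + ∑ s, z s * Q s t) ∧ ((∀ t, 0 ≤ b t) → ∀ t, 0 ≤ z t) := by
  have core : ∀ h : ι → ℝ, (∀ s, 0 ≤ h s) → (∀ t, h t ≤ ∑ s, h s * Q s t) → ∀ s, h s = 0 := by
    intro h h0 hh s
    by_contra hs
    refine hC {s | 0 < h s} ⟨s, lt_of_le_of_ne (h0 s) (Ne.symm hs)⟩ fun s hs => ?_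
    exact support_closed_of_subinvariant hQ0 hQ1 h0 hh hs
  let L : (ι → ℝ) →ₗ[ℝ] (ι → ℝ) := LinearMap.id - (Matrix.of Q).vecMulLinear
  have hL : ∀ z t, L z t = z t - ∑ s, z s * Q s t := fun z t => rfl
  -- If `z` is invariant, `|z|` is subinvariant by the triangle inequality, hence zero. In finite
  -- dimension injectivity gives solvability.
  have inj : Function.Injective L := by
    rw [injective_iff_map_eq_zero]
    intro z hz
    have hz' : ∀ t, z t = ∑ s, z s * Q s t := fun t => by
      have := congrFun hz t
      rw [hL, Pi.zero_apply] at this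
      linarith
    have := core (fun s => |z s|) (fun s => abs_nonneg _) fun t => by
      conv_lhs => rw [hz' t]
      refine (Finset.abs_sum_le_sum_abs _ _).trans (Finset.sum_le_sum fun s _ => ?_)
      rw [abs_mul, abs_of_nonneg (hQ0 s t)]
    exact funext fun s => abs_eq_zero.1 (this s)
  obtain ⟨z, hz⟩ := LinearMap.injective_iff_surjective.1 inj b
  have hz' : ∀ t, z t = b t + ∑ s, z s * Q s t := fun t => by
    have := congrFun hz t
    rw [hL] at this
    linarith
  refine ⟨z, hz', fun hb t => ?_⟩
  -- For a nonnegative source, the negative part of the solution is subinvariant.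
  have := core (fun s => max (-z s) 0) (fun s => le_max_right _ _) (fun t => ?_) t
  · have h1 := le_max_left (-z t) 0
    rw [this] at h1
    linarith
  · refine max_le ?_ (Finset.sum_nonneg fun s _ => mul_nonneg (le_max_right _ _) (hQ0 s t))
    have h1 : ∑ s, (-z s) * Q s t ≤ ∑ s, max (-z s) 0 * Q s t :=
      Finset.sum_le_sum fun s _ => mul_le_mul_of_nonneg_right (le_max_left _ _) (hQ0 s t)
    have h2 := hz' t
    have h3 := hb t
    simp only [neg_mul, Finset.sum_neg_distrib] at h1
    linarith

end Substochastic

/-! ### End components inside closed sets of states -/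

namespace MDP
variable {S : Type*} {Act : Type*} [Fintype S]

theorem mem_act_iff {M : MDP S Act} {s : S} {α : Act} : α ∈ M.act s ↔ ∑ t, M.P s α t = 1 := Iff.rfl

theorem IsEC.exists_mec [Finite Act] {M : MDP S Act} {E : Set (S × Act)} (hE : M.IsEC E) :
    ∃ F : M.MEC, E ⊆ F.1 := by
  obtain ⟨F, hEF, hF⟩ := exists_maximal_ge_of_wellFoundedGT M.IsEC E hE
  exact ⟨⟨F, hF⟩, hEF⟩

/-- Induction along the connectedness of the component; it serves to propagate membership in a
closed set as well as positivity of a vector. -/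
theorem MEC.mem_of_mem_states {M : MDP S Act} (F : M.MEC) {C : Set S} {s : S} (hs : s ∈ F.states)
    (hsC : s ∈ C) (hC : ∀ u ∈ C, ∀ α t, (u, α) ∈ F.1 → 0 < M.P u α t → t ∈ C) :
    F.states ⊆ C := by
  intro t ht
  have := F.2.prop.connected s hs t ht
  clear ht
  induction this with
  | refl => exact hsC
  | tail _ h ih =>
    obtain ⟨α, hα, hP⟩ := h
    exact hC _ ih α _ hα hP

/-- A closed set of states without terminal states, in a sub-MDP `R` that includes the maximal end
components it meets, contains a maximal end component that `R` does not leave. -/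
theorem exists_mec_of_closed [Finite Act] (M : MDP S Act) {R : S → Act → Prop} {C : Set S}
    (hne : C.Nonempty) (henabled : ∀ s ∈ C, ∀ α, R s α → α ∈ M.act s)
    (hnonterm : ∀ s ∈ C, ∃ α, R s α)
    (hclosed : ∀ s ∈ C, ∀ α t, R s α → 0 < M.P s α t → t ∈ C)
    (hR : ∀ F : M.MEC, ∀ s ∈ F.states, s ∈ C → ∀ t α, (t, α) ∈ F.1 → R t α) :
    ∃ F : M.MEC, F.states ⊆ C ∧ ∀ u ∈ F.states, ∀ α, R u α → (u, α) ∈ F.1 := by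
  -- What is reachable from a point of a minimal closed set is again closed, hence the whole set; so
  -- the `R`-pairs over `D` form an end component.
  obtain ⟨D, hDC, hD⟩ := exists_minimal_le_of_wellFoundedLT
    (fun D : Set S => D.Nonempty ∧ D ⊆ C ∧ ∀ s ∈ D, ∀ α t, R s α → 0 < M.P s α t → t ∈ D) C
    ⟨hne, subset_rfl, hclosed⟩
  obtain ⟨hDne, -, hDcl⟩ := hD.prop
  have hstates : statesOf {p : S × Act | p.1 ∈ D ∧ R p.1 p.2} = D := by
    ext s
    refine ⟨fun ⟨α, h⟩ => h.1, fun h => ?_⟩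
    obtain ⟨α, hα⟩ := hnonterm s (hDC h)
    exact ⟨α, h, hα⟩
  have hEC : M.IsEC {p : S × Act | p.1 ∈ D ∧ R p.1 p.2} := by
    refine ⟨?_, fun s α h => henabled s (hDC h.1) α h.2, ?_, ?_⟩
    · obtain ⟨s, hs⟩ := hDne
      obtain ⟨α, hα⟩ := hnonterm s (hDC hs)
      exact ⟨(s, α), hs, hα⟩
    · intro s α t h ht
      rw [hstates]
      exact hDcl s h.1 α t h.2 ht
    · rw [hstates]
      intro s hs t ht
      have hsub : {t | t ∈ D ∧ Relation.ReflTransGen (fun x y => ∃ α,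
          (x, α) ∈ {p : S × Act | p.1 ∈ D ∧ R p.1 p.2} ∧ 0 < M.P x α y) s t} ⊆ D :=
        fun t h => h.1
      have := hD.le_of_le (y := {t | t ∈ D ∧ Relation.ReflTransGen (fun x y => ∃ α,
          (x, α) ∈ {p : S × Act | p.1 ∈ D ∧ R p.1 p.2} ∧ 0 < M.P x α y) s t}) ⟨⟨s, hs, Relation.ReflTransGen.refl⟩, hsub.trans hDC,
        fun u hu α t hα ht => ⟨hDcl u hu.1 α t hα ht, hu.2.tail ⟨α, ⟨hu.1, hα⟩, ht⟩⟩⟩ hsub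
      exact (this ht).2
  obtain ⟨F, hF⟩ := hEC.exists_mec
  obtain ⟨s, hs⟩ := hDne
  obtain ⟨α, hα⟩ := hnonterm s (hDC hs)
  have hsF : s ∈ F.states := ⟨α, hF ⟨hs, hα⟩⟩
  -- The maximal component `F` could be larger than `D`; since `R` includes its pairs by `hR`, it
  -- cannot leave the closed set `D`.
  have hFD : F.states ⊆ D := F.mem_of_mem_states hsF hs fun u hu α t hα ht =>
    hDcl u hu α t (hR F s hsF (hDC hs) u α hα) ht
  exact ⟨F, hFD.trans hDC, fun u hu α hα => hF ⟨hFD hu, hα⟩⟩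

end MDP

/-! ### Circulations in maximal end components -/

namespace MDP
variable {S : Type*} {Act : Type*} [Fintype S]

/-- The state-action pairs that belong to a maximal end component. -/
def InMEC (M : MDP S Act) (s : S) (α : Act) : Prop := ∃ E : M.MEC, (s, α) ∈ E.1

theorem InMEC.mem {M : MDP S Act} {s : S} {α : Act} (h : M.InMEC s α) {E : M.MEC}
    (hs : s ∈ E.states) : (s, α) ∈ E.1 := by
  obtain ⟨F, hF⟩ := h
  rwa [MEC.eq_of_mem hs (show s ∈ F.states from ⟨α, hF⟩)]

variable [Fintype Act]

open Classical in
/-- The uniform distribution over the actions that belong, in `s`, to a maximal end component. -/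
noncomputable def mecWeight (M : MDP S Act) (s : S) (α : Act) : ℝ≥0 :=
  if M.InMEC s α then ((Finset.univ.filter (M.InMEC s)).card : ℝ≥0)⁻¹ else 0

theorem mecWeight_ne_zero {M : MDP S Act} {s : S} {α : Act} :
    M.mecWeight s α ≠ 0 ↔ M.InMEC s α := by
  classical
  rw [mecWeight]
  split_ifs with h
  · simp only [h, iff_true]
    refine inv_ne_zero (Nat.cast_ne_zero.2 (Finset.card_ne_zero_of_mem (a := α) ?_))
    simpa using h
  · simpa using h

theorem sum_mecWeight {M : MDP S Act} {E : M.MEC} {s : S} (hs : s ∈ E.states) :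
    ∑ α, M.mecWeight s α = 1 := by
  classical
  obtain ⟨α, hα⟩ := hs
  simp only [mecWeight]
  rw [← Finset.sum_filter, Finset.sum_const, nsmul_eq_mul]
  refine mul_inv_cancel₀ (Nat.cast_ne_zero.2 (Finset.card_ne_zero_of_mem (a := α) ?_))
  simpa using ⟨E, hα⟩

/-- The transition probabilities under the uniform choice of actions in maximal end components. -/
noncomputable def mecTrans (M : MDP S Act) (s t : S) : ℝ≥0 := ∑ α, M.mecWeight s α * M.P s α t

theorem mecTrans_pos {M : MDP S Act} {s t : S} {α : Act} (h : M.InMEC s α) (ht : 0 < M.P s α t) :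
    0 < M.mecTrans s t :=
  (mul_pos (pos_iff_ne_zero.2 (mecWeight_ne_zero.2 h)) ht).trans_le
    (Finset.single_le_sum (f := fun α => M.mecWeight s α * M.P s α t) (fun _ _ => zero_le)
      (Finset.mem_univ α))

theorem mecTrans_eq_zero {M : MDP S Act} {E : M.MEC} {s t : S}
    (h : s ∈ E.states ∧ t ∉ E.states ∨ s ∉ E.states ∧ t ∈ E.states) :
    M.mecTrans s t = 0 := by
  refine Finset.sum_eq_zero fun α _ => ?_
  by_contra h0
  rw [mul_eq_zero, not_or] at h0
  have h1 := mecWeight_ne_zero.1 h0.1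
  have hP := pos_iff_ne_zero.2 h0.2
  rcases h with ⟨hs, ht⟩ | ⟨hs, ht⟩
  · exact ht (E.2.prop.closed s α t (h1.mem hs) hP)
  · obtain ⟨F, hF⟩ := h1
    have := MEC.eq_of_mem ht (F.2.prop.closed s α t hF hP)
    exact hs (this ▸ ⟨α, hF⟩)

theorem sum_mecTrans {M : MDP S Act} {E : M.MEC} {s : S} (hs : s ∈ E.states) :
    ∑ t, M.mecTrans s t = 1 := by
  simp only [mecTrans]
  rw [Finset.sum_comm, ← sum_mecWeight hs]
  refine Finset.sum_congr rfl fun α _ => ?_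
  rw [← Finset.mul_sum]
  by_cases h : M.mecWeight s α = 0
  · rw [h, zero_mul]
  · rw [mem_act_iff.1 (E.2.prop.enabled s α ((mecWeight_ne_zero.1 h).mem hs)), mul_one]

/-- A balanced source term on a maximal end component is compensated by a circulation that is
positive in all states of the component. -/
theorem MEC.exists_circulation {M : MDP S Act} (E : M.MEC) {b : S → ℝ}
    (hb : ∀ s, s ∉ E.states → b s = 0) (hsum : ∑ s, b s = 0) :
    ∃ y : S → ℝ, (∀ s ∈ E.states, 0 < y s) ∧ (∀ s, s ∉ E.states → y s = 0) ∧
      ∀ t, y t = b t + ∑ s, y s * M.mecTrans s t := by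
  classical
  obtain ⟨⟨u, α₀⟩, hu⟩ := E.2.prop.nonempty
  have hu : u ∈ E.states := ⟨α₀, hu⟩
  -- Deleting the row of one state `u` makes the matrix lossy: by connectedness, every closed set
  -- inside the component would contain `u`.
  let Q : S → S → ℝ := fun s t => if s ∈ E.states ∧ s ≠ u then (M.mecTrans s t : ℝ) else 0
  have hQpos : ∀ s ∈ E.states, s ≠ u → ∀ t, Q s t = M.mecTrans s t := fun s hs hsu t =>
    if_pos ⟨hs, hsu⟩
  have hQsum : ∀ s, ∑ t, Q s t = if s ∈ E.states ∧ s ≠ u then 1 else 0 := by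
    intro s
    by_cases h : s ∈ E.states ∧ s ≠ u
    · simp only [Q, if_pos h]
      exact_mod_cast sum_mecTrans h.1
    · simp [Q, if_neg h]
  have hQ0 : ∀ s t, 0 ≤ Q s t := fun s t => by
    simp only [Q]
    split_ifs
    exacts [NNReal.coe_nonneg _, le_rfl]
  have sol := exists_balance_solution hQ0
    (fun s => by rw [hQsum]; split_ifs <;> norm_num)
    (by
      rintro C ⟨s, hs⟩ hC
      have hCE : ∀ s ∈ C, s ∈ E.states ∧ s ≠ u := fun s hs => by
        by_contra h
        have := (hC s hs).1
        rw [hQsum, if_neg h] at this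
        exact zero_ne_one this
      refine (hCE u (E.mem_of_mem_states (hCE s hs).1 hs (fun v hv α t hα ht => ?_) hu)).2 rfl
      refine (hC v hv).2 t ?_
      rw [hQpos v (hCE v hv).1 (hCE v hv).2]
      exact_mod_cast mecTrans_pos ⟨E, hα⟩ ht)
  -- Inside the component mass is lost only at `u`, so summing the equation shows that `z u` is the
  -- total source.
  have key : ∀ {b z : S → ℝ}, (∀ s, s ∉ E.states → b s = 0) →
      (∀ t, z t = b t + ∑ s, z s * Q s t) → (∀ s, s ∉ E.states → z s = 0) ∧ z u = ∑ s, b s := by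
    intro b z hb hz
    have hz0 : ∀ s, s ∉ E.states → z s = 0 := by
      intro t ht
      rw [hz, hb t ht, zero_add]
      refine Finset.sum_eq_zero fun s _ => ?_
      by_cases h : s ∈ E.states ∧ s ≠ u
      · rw [hQpos s h.1 h.2, mecTrans_eq_zero (Or.inl ⟨h.1, ht⟩), NNReal.coe_zero, mul_zero]
      · simp only [Q, if_neg h, mul_zero]
    refine ⟨hz0, ?_⟩
    have h1 : ∑ t, z t = ∑ t, b t + ∑ s, z s * ∑ t, Q s t := by
      conv_lhs => rw [Finset.sum_congr rfl fun t _ => hz t]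
      rw [Finset.sum_add_distrib, Finset.sum_comm]
      simp only [Finset.mul_sum]
    have h2 : ∑ s, z s * ∑ t, Q s t = ∑ s, z s - z u := by
      rw [eq_sub_iff_add_eq, ← Finset.sum_erase_add _ _ (Finset.mem_univ u), hQsum u]
      rw [← Finset.sum_erase_add Finset.univ z (Finset.mem_univ u)]
      simp only [ne_eq, not_true_eq_false, and_false, if_false, mul_zero, add_zero]
      congr 1
      refine Finset.sum_congr rfl fun s hs => ?_
      rw [hQsum]
      by_cases h : s ∈ E.states
      · rw [if_pos ⟨h, Finset.ne_of_mem_erase hs⟩, mul_one]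
      · rw [hz0 s h, zero_mul]
    linarith
  obtain ⟨z, hz, -⟩ := sol b
  obtain ⟨hz0, hzu⟩ := key hb hz
  have hb' : ∀ s, s ∉ E.states → (M.mecTrans u s : ℝ) = 0 := fun s hs => by
    rw [mecTrans_eq_zero (Or.inl ⟨hu, hs⟩), NNReal.coe_zero]
  -- With the deleted row as source, `w u = 1`, so `w` is stationary for the full matrix.
  obtain ⟨w, hw, hwnn⟩ := sol fun t => M.mecTrans u t
  obtain ⟨hw0, hwu⟩ := key hb' hw
  replace hwnn := hwnn fun t => NNReal.coe_nonneg _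
  have hwu : w u = 1 := hwu.trans (by exact_mod_cast sum_mecTrans hu)
  -- The total source is zero, so `z u = 0` and the deleted row does not matter.
  have hzeq : ∀ t, z t = b t + ∑ s, z s * M.mecTrans s t := by
    intro t
    rw [hz]
    congr 1
    refine Finset.sum_congr rfl fun s _ => ?_
    by_cases h : s ∈ E.states
    · by_cases hsu : s = u
      · rw [hsu, hzu, hsum, zero_mul, zero_mul]
      · rw [hQpos s h hsu]
    · rw [hz0 s h, zero_mul, zero_mul]
  have hweq : ∀ t, w t = ∑ s, w s * M.mecTrans s t := by
    intro t
    rw [hw, ← Finset.sum_erase_add _ _ (Finset.mem_univ u),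
      ← Finset.sum_erase_add _ _ (Finset.mem_univ u), hwu]
    simp only [Q, ne_eq, not_true_eq_false, and_false, if_false, mul_zero, add_zero, one_mul]
    rw [add_comm]
    congr 1
    refine Finset.sum_congr rfl fun s hs => ?_
    by_cases h : s ∈ E.states
    · rw [if_pos ⟨h, Finset.ne_of_mem_erase hs⟩]
    · rw [hw0 s h, zero_mul, zero_mul]
  have hwpos : ∀ s ∈ E.states, 0 < w s := by
    refine E.mem_of_mem_states (C := {s | 0 < w s}) hu (by simp [hwu]) fun v hv α t hα ht => ?_
    rw [Set.mem_ofPred_eq, hweq t]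
    exact (mul_pos hv (NNReal.coe_pos.2 (mecTrans_pos ⟨E, hα⟩ ht))).trans_le
      (Finset.single_le_sum (f := fun s => w s * (M.mecTrans s t : ℝ))
        (fun s _ => mul_nonneg (hwnn s) (NNReal.coe_nonneg _)) (Finset.mem_univ v))
  -- The factor of `w` is so large that its multiple exceeds `|z s|` at each `s` of the component.
  -- Outside, `w v = 0` and the summand is `0` by the convention for division by zero.
  refine ⟨fun s => z s + (∑ v, (|z v| + 1) / w v) * w s, fun s hs => ?_, fun s hs => ?_,
    fun t => ?_⟩
  · have h1 : (|z s| + 1) / w s ≤ ∑ v, (|z v| + 1) / w v :=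
      Finset.single_le_sum (f := fun v => (|z v| + 1) / w v)
        (fun v _ => div_nonneg (by positivity) (hwnn v)) (Finset.mem_univ s)
    have h2 := (div_le_iff₀ (hwpos s hs)).1 h1
    have h3 := neg_abs_le (z s)
    linarith
  · simp only [hz0 s hs, hw0 s hs, mul_zero, add_zero]
  · simp only [add_mul, Finset.sum_add_distrib, mul_assoc]
    rw [← Finset.mul_sum, ← hweq, ← add_assoc, ← hzeq]

open Classical in
/-- Circulations as in `MEC.exists_circulation`, simultaneously in several components. -/
theorem exists_circulation (M : MDP S Act) (A : M.MEC → Prop) {b : S → ℝ}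
    (hsum : ∀ E, A E → ∑ s with s ∈ E.states, b s = 0) :
    ∃ y : S → ℝ, (∀ E : M.MEC, A E → ∀ s ∈ E.states, 0 < y s) ∧
      (∀ s, (∀ E : M.MEC, A E → s ∉ E.states) → y s = 0) ∧
      ∀ t, (∃ E : M.MEC, A E ∧ t ∈ E.states) → y t = b t + ∑ s, y s * M.mecTrans s t := by
  have h1 : ∀ E : M.MEC, ∃ y : S → ℝ, (A E → ∀ s ∈ E.states, 0 < y s) ∧
      (∀ s, ¬ (A E ∧ s ∈ E.states) → y s = 0) ∧
      ∀ t, A E → t ∈ E.states → y t = b t + ∑ s, y s * M.mecTrans s t := by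
    intro E
    by_cases hE : A E
    · obtain ⟨y, hy1, hy2, hy3⟩ := E.exists_circulation
        (b := fun s => if s ∈ E.states then b s else 0) (fun s hs => if_neg hs)
        (by rw [← Finset.sum_filter]; exact hsum E hE)
      refine ⟨y, fun _ => hy1, fun s hs => hy2 s fun h => hs ⟨hE, h⟩, fun t _ ht => ?_⟩
      rw [hy3 t, if_pos ht]
    · exact ⟨fun _ => 0, fun h => absurd h hE, fun _ _ => rfl, fun _ h => absurd h hE⟩
  choose y hy1 hy2 hy3 using h1
  have : Finite M.MEC := inferInstanceAs (Finite {E : Set (S × Act) // Maximal M.IsEC E})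
  let _ : Fintype M.MEC := Fintype.ofFinite _
  -- Distinct maximal end components are disjoint, so at most one summand is nonzero at each state.
  have hval : ∀ E : M.MEC, A E → ∀ s ∈ E.states, ∑ F, y F s = y E s := by
    intro E hE s hs
    refine Finset.sum_eq_single E (fun F _ hF => hy2 F s fun h => hF ?_) (by simp)
    exact MEC.eq_of_mem h.2 hs
  refine ⟨fun s => ∑ E, y E s, fun E hE s hs => ?_, fun s hs => ?_, ?_⟩
  · simp only [hval E hE s hs]
    exact hy1 E hE s hs
  · exact Finset.sum_eq_zero fun E _ => hy2 E s fun h => hs E h.1 h.2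
  · rintro t ⟨E, hE, ht⟩
    simp only [hval E hE t ht]
    rw [hy3 E t hE ht]
    congr 1
    refine Finset.sum_congr rfl fun s _ => ?_
    by_cases hs : s ∈ E.states
    · rw [hval E hE s hs]
    · rw [mecTrans_eq_zero (Or.inr ⟨hs, ht⟩), NNReal.coe_zero, mul_zero, mul_zero]

end MDP

namespace MDP
variable {S : Type*} {Act : Type*} [Fintype S]

/-! ### Finiteness of the frequencies -/

namespace MRScheduler
variable [Fintype Act] {M : MDP S Act} (𝔖 : M.MRScheduler)

theorem sum_trans (s : S) : ∑ t, 𝔖.trans s t = ∑ α, 𝔖.prob s α := by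
  simp only [trans]
  rw [Finset.sum_comm]
  refine Finset.sum_congr rfl fun α _ => ?_
  rw [← Finset.mul_sum]
  by_cases h : 𝔖.prob s α = 0
  · rw [h, zero_mul]
  · rw [mem_act_iff.1 (𝔖.supp s α h), mul_one]

theorem prob_eq_zero_of_terminal {s : S} (h : M.Terminal s) (α : Act) : 𝔖.prob s α = 0 := by
  by_contra hα
  have := 𝔖.supp s α hα
  rw [show M.act s = ∅ from h] at this
  exact this

theorem sum_trans_le_one (s : S) : ∑ t, 𝔖.trans s t ≤ 1 := by
  rw [sum_trans]
  by_cases h : M.Terminal s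
  · simp [𝔖.prob_eq_zero_of_terminal h]
  · exact (𝔖.sum_prob s h).le

theorem trans_pos {s t : S} {α : Act} (h : 𝔖.prob s α ≠ 0) (ht : 0 < M.P s α t) :
    0 < 𝔖.trans s t :=
  (mul_pos (pos_iff_ne_zero.2 h) ht).trans_le
    (Finset.single_le_sum (f := fun α => 𝔖.prob s α * M.P s α t) (fun _ _ => zero_le)
      (Finset.mem_univ α))

/-- The expected frequencies of all states are finite if no set of states traps the paths. -/
theorem stateFreq_ne_top
    (hC : ∀ C : Set S, C.Nonempty → ¬ ∀ s ∈ C, ∑ t, 𝔖.trans s t = 1 ∧ ∀ t, 0 < 𝔖.trans s t → t ∈ C)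
    (t : S) : 𝔖.stateFreq t ≠ ⊤ := by
  classical
  obtain ⟨z, hz, hz0⟩ := exists_balance_solution (Q := fun s t => (𝔖.trans s t : ℝ))
    (fun _ _ => NNReal.coe_nonneg _) (fun s => by exact_mod_cast 𝔖.sum_trans_le_one s)
    (fun C hne h => hC C hne fun s hs => by exact_mod_cast h s hs)
    (fun t => if t = M.init then 1 else 0)
  replace hz0 := hz0 fun t => by split_ifs <;> norm_num
  lift z to S → ℝ≥0 using hz0
  -- The finite solution `z` of the balance equations dominates the least one.
  refine ne_top_of_le_ne_top (ENNReal.coe_ne_top (r := z t))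
    (𝔖.stateFreq_le (x := fun t => (z t : ℝ≥0∞)) (fun t => le_of_eq ?_) t)
  have h : z t = (if t = M.init then 1 else 0) + ∑ s, z s * 𝔖.trans s t := by
    ext
    refine (hz t).trans ?_
    push_cast
    split_ifs <;> simp
  conv_rhs => rw [h]
  push_cast
  split_ifs <;> simp

end MRScheduler

/-! ### The transitions of the quotient -/

theorem toQuot_eq_mec {M : MDP S Act} {s : S} {E : M.MEC} :
    M.toQuot s = .mec E ↔ s ∈ E.states := by
  refine ⟨fun h => ?_, toQuot_of_mem⟩
  by_cases hs : ∃ F : M.MEC, s ∈ F.states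
  · obtain ⟨F, hF⟩ := hs
    rw [toQuot_of_mem hF] at h
    cases h
    exact hF
  · rw [toQuot_of_notMem fun F hF => hs ⟨F, hF⟩] at h
    cases h

theorem toQuot_eq_keep {M : MDP S Act} {s t : S} {h : ∀ E : M.MEC, t ∉ E.states} :
    M.toQuot s = .keep t h ↔ s = t := by
  refine ⟨fun e => ?_, ?_⟩
  · by_cases hs : ∃ F : M.MEC, s ∈ F.states
    · obtain ⟨F, hF⟩ := hs
      rw [toQuot_of_mem hF] at e
      cases e
    · rw [toQuot_of_notMem fun F hF => hs ⟨F, hF⟩] at e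
      cases e
      rfl
  · rintro rfl
    exact toQuot_of_notMem h

theorem toQuot_ne_bot (M : MDP S Act) (s : S) : M.toQuot s ≠ .bot := by
  by_cases hs : ∃ F : M.MEC, s ∈ F.states
  · obtain ⟨F, hF⟩ := hs
    rw [toQuot_of_mem hF]
    exact nofun
  · rw [toQuot_of_notMem fun F hF => hs ⟨F, hF⟩]
    exact nofun

theorem exists_toQuot_eq {M : MDP S Act} {c : M.QState} (hc : c ≠ .bot) : ∃ s, M.toQuot s = c := by
  rcases c with ⟨s, h⟩ | E | _
  · exact ⟨s, toQuot_eq_keep.2 rfl⟩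
  · obtain ⟨⟨s, α⟩, h⟩ := E.2.prop.nonempty
    exact ⟨s, toQuot_of_mem ⟨α, h⟩⟩
  · exact absurd rfl hc

open Classical in
theorem filter_toQuot_keep {M : MDP S Act} {s : S} (h : ∀ E : M.MEC, s ∉ E.states) :
    Finset.univ.filter (fun t => M.toQuot t = .keep s h) = {s} := by
  ext t
  simp [toQuot_eq_keep]

open Classical in
theorem filter_toQuot_mec {M : MDP S Act} (E : M.MEC) :
    Finset.univ.filter (fun t => M.toQuot t = .mec E) = Finset.univ.filter (· ∈ E.states) := by
  ext t
  simp [toQuot_eq_mec]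

open Classical in
-- A uniform formula for all kinds of quotient states, which lets flows be summed over the fibres of
-- `toQuot` without case distinctions.
theorem quotP_some (M : MDP S Act) (c d : M.QState) (α : Act) :
    M.quotP c (some α) d = ∑ s with M.toQuot s = c ∧ ¬ M.InMEC s α, M.probPreimage s α d := by
  rcases c with ⟨s, h⟩ | E | _
  · rw [quotP, Finset.sum_eq_single_of_mem s]
    · simp only [Finset.mem_filter, Finset.mem_univ, true_and, toQuot_eq_keep]
      exact fun ⟨E, hE⟩ => h E ⟨α, hE⟩
    · intro t ht hts
      simp only [Finset.mem_filter, Finset.mem_univ, true_and, toQuot_eq_keep] at ht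
      exact absurd ht.1 hts
  · rw [quotP]
    congr 1
    ext s
    simp only [Finset.mem_filter, Finset.mem_univ, true_and, toQuot_eq_mec]
    exact and_congr_right fun hs => not_congr ⟨fun h => ⟨E, h⟩, fun h => h.mem hs⟩
  · rw [quotP, Finset.filter_false_of_mem, Finset.sum_empty]
    exact fun s _ h => toQuot_ne_bot M s h.1

theorem quotP_none {M : MDP S Act} (c : M.QState) {d : M.QState} (hd : d ≠ .bot) :
    M.quotP c none d = 0 := by
  rcases c with ⟨s, h⟩ | E | _ <;> simp [quotP, hd]

theorem quotP_pos {M : MDP S Act} {s t : S} {α : Act} (h : ¬ M.InMEC s α) (ht : 0 < M.P s α t) :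
    0 < M.quotP (M.toQuot s) (some α) (M.toQuot t) := by
  classical
  rw [quotP_some]
  refine (?_ : 0 < M.probPreimage s α (M.toQuot t)).trans_le
    (Finset.single_le_sum (f := fun s => M.probPreimage s α (M.toQuot t)) (fun _ _ => zero_le) ?_)
  · refine ht.trans_le (Finset.single_le_sum (f := fun t => M.P s α t) (fun _ _ => zero_le) ?_)
    simp
  · simpa using h

variable [Fintype Act]

theorem exists_mem_act_of_mem_act_quotient {M : MDP S Act} {hM : M.DisjointActions} {c : M.QState}
    {α : Act} (h : some α ∈ (M.mecQuotient hM).act c) :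
    ∃ s, M.toQuot s = c ∧ ¬ M.InMEC s α ∧ α ∈ M.act s := by
  classical
  have h1 : ∑ d, M.quotP c (some α) d = 1 := h
  simp only [quotP_some] at h1
  rw [Finset.sum_comm] at h1
  simp only [sum_probPreimage] at h1
  obtain ⟨s, hs, hs'⟩ := Finset.exists_ne_zero_of_sum_ne_zero (h1.trans_ne one_ne_zero)
  simp only [Finset.mem_filter, Finset.mem_univ, true_and] at hs
  exact ⟨s, hs.1, hs.2, (M.sum_P s α).resolve_left hs'⟩

/-! ### Flow in the quotient: finiteness, exits and entries -/

section Quotient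
variable {M : MDP S Act} {hM : M.DisjointActions} (𝔖 : (M.mecQuotient hM).MRScheduler)

theorem prob_bot (o : Option Act) : 𝔖.prob .bot o = 0 := by
  by_contra h
  have : ∑ d, M.quotP .bot o d = 1 := 𝔖.supp _ _ h
  simp [quotP] at this

/-- In the quotient, the expected frequencies of the states are finite. -/
theorem stateFreq_quotient_ne_top (c : M.QState) : 𝔖.stateFreq c ≠ ⊤ := by
  refine 𝔖.stateFreq_ne_top (fun C hne hC => ?_) c
  have hbot : ∀ c ∈ C, c ≠ .bot := by
    rintro _ hc rfl
    have := (hC _ hc).1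
    rw [𝔖.sum_trans] at this
    simp [prob_bot] at this
  -- A trap cannot use `τ`, which leads to `⊥`, where all mass is lost.
  have hsome : ∀ c ∈ C, ∃ α : Act, 𝔖.prob c (some α) ≠ 0 := by
    intro c hc
    have h1 := (hC c hc).1
    rw [𝔖.sum_trans] at h1
    obtain ⟨o, -, ho⟩ := Finset.exists_ne_zero_of_sum_ne_zero (h1.trans_ne one_ne_zero)
    rcases o with _ | α
    · exfalso
      refine hbot _ ((hC c hc).2 .bot (𝔖.trans_pos ho ?_)) rfl
      have h2 : ∑ d, M.quotP c none d = 1 := 𝔖.supp _ _ ho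
      rw [Finset.sum_eq_single .bot (fun d _ hd => quotP_none c hd) (by simp)] at h2
      exact one_pos.trans_eq h2.symm
    · exact ⟨α, ho⟩
  -- The trap is lifted to `M`, where all pairs inside MECs are added to those used by `𝔖`. The
  -- resulting `F` is left by no used pair, but `hsome` provides an exit at `mec F`.
  obtain ⟨F, hF, hF'⟩ := M.exists_mec_of_closed (C := M.toQuot ⁻¹' C)
    (R := fun s α => M.InMEC s α ∨ α ∈ M.act s ∧ 𝔖.prob (M.toQuot s) (some α) ≠ 0)
    (by
      obtain ⟨c, hc⟩ := hne
      obtain ⟨s, hs⟩ := exists_toQuot_eq (hbot c hc)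
      exact ⟨s, by rwa [Set.mem_preimage, hs]⟩)
    (by
      rintro s - α (⟨E, hE⟩ | h)
      exacts [E.2.prop.enabled s α hE, h.1])
    (by
      intro s hs
      by_cases h : ∃ E : M.MEC, s ∈ E.states
      · obtain ⟨E, α, hα⟩ := h
        exact ⟨α, Or.inl ⟨E, hα⟩⟩
      · have e := toQuot_of_notMem fun E hE => h ⟨E, hE⟩
        obtain ⟨α, hα⟩ := hsome _ hs
        obtain ⟨u, hu, -, hu'⟩ := exists_mem_act_of_mem_act_quotient (𝔖.supp _ _ hα)
        rw [e, toQuot_eq_keep] at hu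
        exact ⟨α, Or.inr ⟨hu ▸ hu', hα⟩⟩)
    (by
      intro s hs α t h ht
      by_cases hin : M.InMEC s α
      · obtain ⟨E, hE⟩ := hin
        rw [Set.mem_preimage, toQuot_of_mem (E.2.prop.closed s α t hE ht)]
        rwa [Set.mem_preimage, toQuot_of_mem (show s ∈ E.states from ⟨α, hE⟩)] at hs
      · exact (hC _ hs).2 _ (𝔖.trans_pos (h.resolve_left hin).2 (quotP_pos hin ht)))
    (fun F _ _ _ t α h => Or.inl ⟨F, h⟩)
  obtain ⟨⟨s, β⟩, hs⟩ := F.2.prop.nonempty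
  have hFC : .mec F ∈ C := by
    have := hF ⟨β, hs⟩
    rwa [Set.mem_preimage, toQuot_of_mem (show s ∈ F.states from ⟨β, hs⟩)] at this
  obtain ⟨α, hα⟩ := hsome _ hFC
  obtain ⟨u, hu, hu1, hu2⟩ := exists_mem_act_of_mem_act_quotient (𝔖.supp _ _ hα)
  exact hu1 ⟨F, hF' u (toQuot_eq_mec.1 hu) α (Or.inr ⟨hu2, by rwa [hu]⟩)⟩

open Classical in
/-- The contribution of the pair `(s, α)` of `M` to the expected frequency of `α` in the quotient;
zero for pairs inside maximal end components. -/
noncomputable def exitFreq (s : S) (α : Act) : ℝ≥0 :=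
  if M.InMEC s α then 0 else
    (𝔖.stateFreq (M.toQuot s)).toNNReal * 𝔖.prob (M.toQuot s) (some α) * ∑ t, M.P s α t

open Classical in
-- The factor `∑ t, M.P s α t` of `exitFreq` is 0 or 1, and where it is 0 the whole row vanishes; so
-- it can be dropped next to `probPreimage`.
theorem sum_exitFreq_mul (c d : M.QState) (α : Act) :
    ∑ s with M.toQuot s = c, exitFreq 𝔖 s α * M.probPreimage s α d =
      (𝔖.stateFreq c).toNNReal * 𝔖.prob c (some α) * M.quotP c (some α) d := by
  rw [quotP_some, ← Finset.filter_filter, Finset.sum_filter (fun s => ¬ M.InMEC s α),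
    Finset.mul_sum]
  refine Finset.sum_congr rfl fun s hs => ?_
  simp only [Finset.mem_filter, Finset.mem_univ, true_and] at hs
  rw [exitFreq, hs]
  by_cases h : M.InMEC s α
  · simp [h]
  · rw [if_neg h, if_pos h]
    rcases M.sum_P s α with h0 | h1
    · have : M.probPreimage s α d = 0 :=
        Finset.sum_eq_zero fun t _ => Finset.sum_eq_zero_iff.1 h0 t (Finset.mem_univ t)
      simp [this]
    · rw [h1, mul_one]

open Classical in
theorem sum_exitFreq (c : M.QState) (α : Act) :
    ∑ s with M.toQuot s = c, exitFreq 𝔖 s α =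
      (𝔖.stateFreq c).toNNReal * 𝔖.prob c (some α) := by
  have h1 : ∑ s with M.toQuot s = c, exitFreq 𝔖 s α =
      ∑ d, ∑ s with M.toQuot s = c, exitFreq 𝔖 s α * M.probPreimage s α d := by
    rw [Finset.sum_comm]
    refine Finset.sum_congr rfl fun s _ => ?_
    rw [← Finset.mul_sum, sum_probPreimage, exitFreq]
    split_ifs
    · simp
    · rcases M.sum_P s α with h | h <;> simp [h]
  rw [h1]
  simp only [sum_exitFreq_mul]
  rw [← Finset.mul_sum]
  by_cases h : 𝔖.prob c (some α) = 0
  · simp [h]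
  · rw [show ∑ d, M.quotP c (some α) d = 1 from 𝔖.supp _ _ h, mul_one]

open Classical in
/-- The expected number of times that `t` is the initial state or is entered by an action outside
the maximal end components. -/
noncomputable def entryFreq (t : S) : ℝ≥0 :=
  (if t = M.init then 1 else 0) + ∑ s, ∑ α, exitFreq 𝔖 s α * M.P s α t

open Classical in
-- This is the balance equation of the quotient at `c`, with the inflow split over the states of the
-- fibre. Since `τ` leads only to `⊥`, it contributes nothing at other states.
theorem sum_entryFreq {c : M.QState} (hc : c ≠ .bot) :
    ∑ t with M.toQuot t = c, entryFreq 𝔖 t = (𝔖.stateFreq c).toNNReal := by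
  have h1 : (𝔖.stateFreq c).toNNReal = (if c = M.toQuot M.init then 1 else 0) +
      ∑ d, (𝔖.stateFreq d).toNNReal * 𝔖.trans d c := by
    rw [← ENNReal.coe_inj, ENNReal.coe_toNNReal (stateFreq_quotient_ne_top 𝔖 c), 𝔖.stateFreq_eq]
    push_cast
    congr 1
    · split_ifs <;> simp_all [mecQuotient]
    · refine Finset.sum_congr rfl fun d _ => ?_
      rw [ENNReal.coe_toNNReal (stateFreq_quotient_ne_top 𝔖 d)]
  rw [h1]
  simp only [entryFreq, Finset.sum_add_distrib]
  congr 1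
  · rw [Finset.sum_ite_eq']
    simp [eq_comm]
  · rw [Finset.sum_comm, ← Finset.sum_fiberwise (s := Finset.univ) (g := M.toQuot)]
    refine Finset.sum_congr rfl fun d _ => ?_
    have h2 : 𝔖.trans d c = ∑ α, 𝔖.prob d (some α) * M.quotP d (some α) c := by
      rw [MRScheduler.trans, Fintype.sum_option,
        show (M.mecQuotient hM).P d none c = 0 from quotP_none d hc, mul_zero, zero_add]
      rfl
    rw [h2, Finset.mul_sum]
    simp only [← mul_assoc, ← sum_exitFreq_mul, probPreimage, Finset.mul_sum]
    rw [Finset.sum_comm (s := Finset.univ) (t := Finset.univ.filter fun s => M.toQuot s = d)]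
    exact Finset.sum_congr rfl fun s _ => Finset.sum_comm

end Quotient
end MDP

namespace MDP
variable {S : Type*} {Act : Type*} [Fintype S]
section Scheduler
variable [Fintype Act] {M : MDP S Act} {hM : M.DisjointActions}
  (𝔖 : (M.mecQuotient hM).MRScheduler)

/-! ### The scheduler -/

/-- The maximal end components that are reached and that the scheduler of the quotient leaves by an
action of `M`. -/
def MEC.Active (E : M.MEC) : Prop := 𝔖.prob (.mec E) tau = 0 ∧ 𝔖.stateFreq (.mec E) ≠ 0

/-- The states that belong to a maximal end component that is not active. -/
def Dead (s : S) : Prop := ∃ E : M.MEC, ¬ E.Active 𝔖 ∧ s ∈ E.states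

theorem sum_prob_mec (E : M.MEC) : ∑ o, 𝔖.prob (.mec E) o = 1 := by
  refine 𝔖.sum_prob _ fun h => ?_
  have : (none : Option Act) ∈ (M.mecQuotient hM).act (.mec E) := by
    change ∑ d, M.quotP (.mec E) none d = 1
    rw [Finset.sum_eq_single .bot (fun d _ hd => quotP_none _ hd) (by simp)]
    simp [quotP]
  rw [show (M.mecQuotient hM).act (.mec E) = ∅ from h] at this
  exact this

theorem prob_keep_none (s : S) (h : ∀ E : M.MEC, s ∉ E.states) : 𝔖.prob (.keep s h) none = 0 := by
  by_contra h0
  have : ∑ d, M.quotP (.keep s h) none d = 1 := 𝔖.supp _ _ h0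
  simp [quotP] at this

theorem sum_prob_keep {s : S} (h : ∀ E : M.MEC, s ∉ E.states) (hs : ¬ M.Terminal s) :
    ∑ α : Act, 𝔖.prob (.keep s h) (some α) = 1 := by
  have h1 : ∑ o, 𝔖.prob (.keep s h) o = 1 := by
    refine 𝔖.sum_prob _ fun ht => ?_
    obtain ⟨α, hα⟩ := Set.nonempty_iff_ne_empty.2 hs
    have : some α ∈ (M.mecQuotient hM).act (.keep s h) := by
      rw [mem_act_iff]
      exact (M.sum_probPreimage s α).trans hα
    rw [show (M.mecQuotient hM).act (.keep s h) = ∅ from ht] at this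
    exact this
  rwa [Fintype.sum_option, prob_keep_none, zero_add] at h1

open Classical in
/-- The paths leave an active component by actions of `M` as often as they enter it. -/
theorem sum_sum_exitFreq {E : M.MEC} (hE : E.Active 𝔖) :
    ∑ s with s ∈ E.states, ∑ α, exitFreq 𝔖 s α = (𝔖.stateFreq (.mec E)).toNNReal := by
  rw [Finset.sum_comm, ← filter_toQuot_mec]
  simp only [sum_exitFreq]
  have h := sum_prob_mec 𝔖 E
  rw [Fintype.sum_option, hE.1, zero_add] at h
  rw [← Finset.mul_sum, h, mul_one]

theorem exitFreq_eq_zero_of_inMEC {s : S} {α : Act} (h : M.InMEC s α) : exitFreq 𝔖 s α = 0 :=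
  if_pos h

/-- Here `hτ` is essential: if `τ` has probability 1, no other action is taken; if it has
probability 0, a component that is not active is unreached. -/
theorem exitFreq_eq_zero_of_dead
    (hτ : ∀ E : M.MEC, 𝔖.prob (.mec E) tau = 0 ∨ 𝔖.prob (.mec E) tau = 1)
    {s : S} (hs : Dead 𝔖 s) (α : Act) : exitFreq 𝔖 s α = 0 := by
  classical
  obtain ⟨E, hE, hs⟩ := hs
  have h : (𝔖.stateFreq (.mec E)).toNNReal * 𝔖.prob (.mec E) (some α) = 0 := by
    rcases hτ E with h | h
    · have : 𝔖.stateFreq (.mec E) = 0 := by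
        by_contra h'
        exact hE ⟨h, h'⟩
      simp [this]
    · have h1 := sum_prob_mec 𝔖 E
      rw [Fintype.sum_option, h, add_eq_left, Finset.sum_eq_zero_iff] at h1
      rw [h1 α (Finset.mem_univ α), mul_zero]
  rw [← sum_exitFreq] at h
  exact Finset.sum_eq_zero_iff.1 h s (by simpa [toQuot_eq_mec] using hs)

theorem mem_act_of_exitFreq_ne_zero {s : S} {α : Act} (h : exitFreq 𝔖 s α ≠ 0) : α ∈ M.act s := by
  refine (M.sum_P s α).resolve_left fun h0 => h ?_
  rw [exitFreq, h0, mul_zero, ite_self]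

theorem mem_act_of_mecWeight_ne_zero {s : S} {α : Act} (h : M.mecWeight s α ≠ 0) : α ∈ M.act s := by
  obtain ⟨E, hE⟩ := mecWeight_ne_zero.1 h
  exact E.2.prop.enabled s α hE

/-- There are a scheduler and state frequencies `x` that, outside the dead states, satisfy the
balance equations and induce the frequencies `exitFreq` outside the maximal end components;
`y` is the part of the frequencies that stays inside the active components. -/
theorem exists_scheduler : ∃ (𝔗 : M.MRScheduler) (x y : S → ℝ≥0),
    (∀ s α, ¬ Dead 𝔖 s → x s * 𝔗.prob s α = y s * M.mecWeight s α + exitFreq 𝔖 s α) ∧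
    (∀ t, ¬ Dead 𝔖 t → x t = entryFreq 𝔖 t + ∑ s, y s * M.mecTrans s t) ∧
    (∀ s, Dead 𝔖 s → y s = 0 ∧ ∀ α, 𝔗.prob s α = M.mecWeight s α) ∧
    ∀ E : M.MEC, E.Active 𝔖 → ∀ s ∈ E.states, 0 < y s := by
  classical
  -- The source is the surplus of entries over exits, whose total over an active component is zero.
  obtain ⟨y, hy1, hy2, hy3⟩ := M.exists_circulation (fun E => E.Active 𝔖)
    (b := fun s => entryFreq 𝔖 s - ∑ α, (exitFreq 𝔖 s α : ℝ)) (fun E hE => by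
      have h1 := sum_sum_exitFreq 𝔖 hE
      rw [← sum_entryFreq 𝔖 (c := .mec E) nofun, filter_toQuot_mec] at h1
      rw [Finset.sum_sub_distrib, sub_eq_zero]
      exact_mod_cast h1.symm)
  have hy0 : ∀ s, 0 ≤ y s := fun s => by
    by_cases h : ∃ E : M.MEC, E.Active 𝔖 ∧ s ∈ E.states
    · obtain ⟨E, hE, hs⟩ := h
      exact (hy1 E hE s hs).le
    · exact (hy2 s fun E hE hs => h ⟨E, hE, hs⟩).ge
  lift y to S → ℝ≥0 using hy0
  replace hy1 : ∀ E : M.MEC, E.Active 𝔖 → ∀ s ∈ E.states, 0 < y s := fun E hE s hs => by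
    exact_mod_cast hy1 E hE s hs
  replace hy2 : ∀ s, (∀ E : M.MEC, E.Active 𝔖 → s ∉ E.states) → y s = 0 := fun s hs => by
    exact NNReal.coe_eq_zero.1 (hy2 s hs)
  replace hy3 : ∀ t, (∃ E : M.MEC, E.Active 𝔖 ∧ t ∈ E.states) →
      y t + ∑ α, exitFreq 𝔖 t α = entryFreq 𝔖 t + ∑ s, y s * M.mecTrans s t := fun t ht => by
    have h := hy3 t ht
    simp only at h
    ext
    push_cast
    linarith
  have hlive : ∀ {s}, ¬ Dead 𝔖 s → ∀ {E : M.MEC}, s ∈ E.states → E.Active 𝔖 := fun hs E hE => by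
    by_contra h
    exact hs ⟨E, h, hE⟩
  have hdead : ∀ {s}, Dead 𝔖 s → ∀ E : M.MEC, E.Active 𝔖 → s ∉ E.states := by
    rintro s ⟨F, hF, hs⟩ E hE hs'
    exact hF (MEC.eq_of_mem hs hs' ▸ hE)
  -- In an active component the desired pair frequencies, circulation plus exits, are normalised by
  -- the state frequency. Dead states only use actions inside their component; states in no
  -- component copy `𝔖`.
  let p : S → Act → ℝ≥0 := fun s α =>
    if ∃ E : M.MEC, s ∈ E.states then
      if Dead 𝔖 s then M.mecWeight s α
      else (y s * M.mecWeight s α + exitFreq 𝔖 s α) / (y s + ∑ β, exitFreq 𝔖 s β)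
    else 𝔖.prob (M.toQuot s) (some α)
  have hpos : ∀ {s}, ¬ Dead 𝔖 s → ∀ {E : M.MEC}, s ∈ E.states →
      y s + ∑ β, exitFreq 𝔖 s β ≠ 0 := fun hs E hE h =>
    (hy1 E (hlive hs hE) _ hE).ne' (add_eq_zero.1 h).1
  refine ⟨⟨p, fun s α h => ?_, fun s hs => ?_⟩, fun s => if ∃ E : M.MEC, s ∈ E.states then
    y s + ∑ β, exitFreq 𝔖 s β else (𝔖.stateFreq (M.toQuot s)).toNNReal, y, fun s α hs => ?_,
    fun t ht => ?_, fun s hs => ⟨hy2 s (hdead hs), fun α => ?_⟩, hy1⟩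
  · simp only [p] at h
    split_ifs at h with h1 h2
    · exact mem_act_of_mecWeight_ne_zero h
    · have h3 := (div_ne_zero_iff.1 h).1
      by_cases h4 : exitFreq 𝔖 s α = 0
      · rw [h4, add_zero] at h3
        exact mem_act_of_mecWeight_ne_zero (mul_ne_zero_iff.1 h3).2
      · exact mem_act_of_exitFreq_ne_zero 𝔖 h4
    · obtain ⟨u, hu, -, hu'⟩ := exists_mem_act_of_mem_act_quotient (𝔖.supp _ _ h)
      rw [toQuot_of_notMem fun E hE => h1 ⟨E, hE⟩, toQuot_eq_keep] at hu
      exact hu ▸ hu'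
  · simp only [p]
    split_ifs with h1 h2
    · exact sum_mecWeight h1.choose_spec
    · obtain ⟨E, hE⟩ := h1
      rw [← Finset.sum_div, Finset.sum_add_distrib, ← Finset.mul_sum, sum_mecWeight hE, mul_one]
      exact div_self (hpos h2 hE)
    · rw [toQuot_of_notMem fun E hE => h1 ⟨E, hE⟩]
      exact sum_prob_keep 𝔖 _ hs
  · simp only [p]
    split_ifs with h1
    · obtain ⟨E, hE⟩ := h1
      exact mul_div_cancel₀ _ (hpos hs hE)
    · rw [hy2 s fun E _ hE => h1 ⟨E, hE⟩, zero_mul, zero_add,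
        toQuot_of_notMem fun E hE => h1 ⟨E, hE⟩, ← sum_exitFreq, filter_toQuot_keep,
        Finset.sum_singleton]
  · simp only
    split_ifs with h1
    · obtain ⟨E, hE⟩ := h1
      exact hy3 t ⟨E, hlive ht hE, hE⟩
    · rw [toQuot_of_notMem fun E hE => h1 ⟨E, hE⟩, ← sum_entryFreq 𝔖 (c := .keep t _) nofun,
        filter_toQuot_keep, Finset.sum_singleton, left_eq_add]
      refine Finset.sum_eq_zero fun s _ => ?_
      by_cases hs : ∃ E : M.MEC, s ∈ E.states
      · obtain ⟨E, hE⟩ := hs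
        rw [mecTrans_eq_zero (Or.inl ⟨hE, fun h => h1 ⟨E, h⟩⟩), mul_zero]
      · rw [hy2 s fun E _ hE => hs ⟨E, hE⟩, zero_mul]
  · obtain ⟨E, -, hE⟩ := id hs
    simp only [p]
    rw [if_pos ⟨E, hE⟩, if_pos hs]

/-- The state frequencies `x` of `exists_scheduler` are the expected frequencies of the states that
are not dead. -/
theorem stateFreq_eq_of_balance
    (hτ : ∀ E : M.MEC, 𝔖.prob (.mec E) tau = 0 ∨ 𝔖.prob (.mec E) tau = 1)
    {𝔗 : M.MRScheduler} {x y : S → ℝ≥0}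
    (h1 : ∀ s α, ¬ Dead 𝔖 s → x s * 𝔗.prob s α = y s * M.mecWeight s α + exitFreq 𝔖 s α)
    (h2 : ∀ t, ¬ Dead 𝔖 t → x t = entryFreq 𝔖 t + ∑ s, y s * M.mecTrans s t)
    (h3 : ∀ s, Dead 𝔖 s → y s = 0 ∧ ∀ α, 𝔗.prob s α = M.mecWeight s α)
    (h4 : ∀ E : M.MEC, E.Active 𝔖 → ∀ s ∈ E.states, 0 < y s) {s : S} (hs : ¬ Dead 𝔖 s) :
    𝔗.stateFreq s = x s := by
  classical
  -- Dead components are never left, so the balance equations of the other states do not involve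
  -- them.
  have hdead : ∀ s t, Dead 𝔖 s → ¬ Dead 𝔖 t → 𝔗.trans s t = 0 := by
    rintro s t hs ht
    have : 𝔗.trans s t = M.mecTrans s t :=
      Finset.sum_congr rfl fun α _ => by rw [(h3 s hs).2]
    obtain ⟨E, hE, hsE⟩ := hs
    rw [this, mecTrans_eq_zero (Or.inl ⟨hsE, fun h => ht ⟨E, hE, h⟩⟩)]
  have hx : ∀ t, ¬ Dead 𝔖 t → x t = (if t = M.init then 1 else 0) +
      ∑ s, (if Dead 𝔖 s then 0 else x s) * 𝔗.trans s t := by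
    intro t ht
    rw [h2 t ht, entryFreq, add_assoc, ← Finset.sum_add_distrib]
    congr 1
    refine Finset.sum_congr rfl fun s _ => ?_
    by_cases hs : Dead 𝔖 s
    · simp [exitFreq_eq_zero_of_dead 𝔖 hτ hs, (h3 s hs).1, hs]
    · rw [if_neg hs, MRScheduler.trans, mecTrans, Finset.mul_sum, Finset.mul_sum,
        ← Finset.sum_add_distrib]
      refine Finset.sum_congr rfl fun α _ => ?_
      rw [← mul_assoc, ← mul_assoc, h1 s α hs, add_mul, add_comm]
  have hle : ∀ t, ¬ Dead 𝔖 t → 𝔗.stateFreq t ≤ x t := by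
    intro t ht
    -- The value `⊤` at dead states makes the inequality trivial there and is harmless elsewhere, as
    -- it is multiplied by a zero transition probability.
    have := 𝔗.stateFreq_le (x := fun s => if Dead 𝔖 s then ⊤ else (x s : ℝ≥0∞)) (fun t => ?_) t
    · simpa only [if_neg ht] using this
    · by_cases ht : Dead 𝔖 t
      · simp [ht]
      · rw [if_neg ht, hx t ht]
        push_cast
        refine add_le_add (by split_ifs <;> simp) (Finset.sum_le_sum fun s _ => ?_)
        by_cases hs : Dead 𝔖 s
        · simp [hdead s t hs ht]
        · simp [hs]
  let F : S → ℝ≥0 := fun s => (𝔗.stateFreq s).toNNReal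
  have hF : ∀ t, ¬ Dead 𝔖 t → (F t : ℝ≥0∞) = 𝔗.stateFreq t := fun t ht =>
    ENNReal.coe_toNNReal (ne_top_of_le_ne_top ENNReal.coe_ne_top (hle t ht))
  have hFeq : ∀ t, ¬ Dead 𝔖 t → F t = (if t = M.init then 1 else 0) +
      ∑ s, (if Dead 𝔖 s then 0 else F s) * 𝔗.trans s t := by
    intro t ht
    rw [← ENNReal.coe_inj, hF t ht, 𝔗.stateFreq_eq]
    push_cast
    congr 1
    · split_ifs <;> simp
    · refine Finset.sum_congr rfl fun s _ => ?_
      by_cases hs : Dead 𝔖 s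
      · simp [hdead s t hs ht]
      · simp [hs, hF s hs]
  have hFle : ∀ t, ¬ Dead 𝔖 t → F t ≤ x t := fun t ht => by
    rw [← ENNReal.coe_le_coe, hF t ht]
    exact hle t ht
  -- The excess of `x` over the expected frequencies; the initial terms cancel in the difference of
  -- the two balance equations.
  let h : S → ℝ := fun s => if Dead 𝔖 s then 0 else (x s : ℝ) - F s
  have h0 : ∀ s, 0 ≤ h s := fun s => by
    simp only [h]
    split_ifs with hs
    exacts [le_rfl, sub_nonneg.2 (NNReal.coe_le_coe.2 (hFle s hs))]
  have hinv : ∀ t, h t ≤ ∑ s, h s * 𝔗.trans s t := by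
    intro t
    by_cases ht : Dead 𝔖 t
    · refine (if_pos ht).trans_le (Finset.sum_nonneg fun s _ => ?_)
      exact mul_nonneg (h0 s) (NNReal.coe_nonneg _)
    · have e1 : ∀ (z : S → ℝ≥0), z t = (if t = M.init then 1 else 0) +
          ∑ s, (if Dead 𝔖 s then 0 else z s) * 𝔗.trans s t → (z t : ℝ) =
          (if t = M.init then 1 else 0) +
          ∑ s, (if Dead 𝔖 s then 0 else (z s : ℝ)) * 𝔗.trans s t := by
        intro z hz
        conv_lhs => rw [hz]
        push_cast
        congr 1
        · split_ifs <;> simp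
        · refine Finset.sum_congr rfl fun s _ => ?_
          split_ifs <;> simp
      have e2 : h t = (x t : ℝ) - F t := if_neg ht
      rw [e2, e1 x (hx t ht), e1 F (hFeq t ht), add_sub_add_left_eq_sub, ← Finset.sum_sub_distrib]
      refine (Finset.sum_congr rfl fun s _ => ?_).le
      simp only [h]
      split_ifs <;> ring
  have hsupp := fun s (hs : 0 < h s) => support_closed_of_subinvariant
    (Q := fun s t => (𝔗.trans s t : ℝ)) (fun _ _ => NNReal.coe_nonneg _)
    (fun s => by exact_mod_cast 𝔗.sum_trans_le_one s) h0 hinv hs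
  have hlive : ∀ s, 0 < h s → ¬ Dead 𝔖 s := fun s hs hd => hs.ne' (if_pos hd)
  have hactive : ∀ E : M.MEC, ∀ s ∈ E.states, 0 < h s → E.Active 𝔖 := fun E s hsE hs => by
    by_contra hE
    exact hlive s hs ⟨E, hE, hsE⟩
  have hnotDead : ∀ E : M.MEC, E.Active 𝔖 → ∀ s ∈ E.states, ¬ Dead 𝔖 s := by
    rintro E hE s hsE ⟨E', hE', hs'⟩
    exact hE' (MEC.eq_of_mem hsE hs' ▸ hE)
  have hprob : ∀ s α, ¬ Dead 𝔖 s → y s * M.mecWeight s α + exitFreq 𝔖 s α ≠ 0 →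
      𝔗.prob s α ≠ 0 := fun s α hs h h' => h (by rw [← h1 s α hs, h', mul_zero])
  by_contra hne
  have hspos : 0 < h s := by
    refine lt_of_le_of_ne (h0 s) fun he => hne ?_
    simp only [h, if_neg hs] at he
    rw [← hF s hs, ENNReal.coe_inj]
    ext
    linarith
  -- The last hypothesis of `exists_mec_of_closed` holds because the circulation is positive: `𝔗`
  -- uses every pair of an active component.
  obtain ⟨E, hEsub, hE⟩ := M.exists_mec_of_closed (C := {s | 0 < h s})
    (R := fun s α => 𝔗.prob s α ≠ 0) ⟨s, hspos⟩ (fun s _ α hα => 𝔗.supp s α hα)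
    (fun s hs => by
      have h5 := (hsupp s hs).1
      have h6 : ∑ α, 𝔗.prob s α = 1 := by
        rw [← 𝔗.sum_trans]
        exact_mod_cast h5
      obtain ⟨α, -, hα⟩ := Finset.exists_ne_zero_of_sum_ne_zero (h6.trans_ne one_ne_zero)
      exact ⟨α, hα⟩)
    (fun s hs α t hα ht => (hsupp s hs).2 t (NNReal.coe_pos.2 (𝔗.trans_pos hα ht)))
    (fun E s hsE hs t α hα => by
      have hE := hactive E s hsE hs
      have ht : t ∈ E.states := ⟨α, hα⟩
      refine hprob t α (hnotDead E hE t ht) fun h0 => ?_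
      exact (mul_pos (h4 E hE t ht) (pos_iff_ne_zero.2 (mecWeight_ne_zero.2 ⟨E, hα⟩))).ne'
        (add_eq_zero.1 h0).1)
  have hEact : E.Active 𝔖 := by
    obtain ⟨⟨u, α⟩, hu⟩ := E.2.prop.nonempty
    exact hactive E u ⟨α, hu⟩ (hEsub ⟨α, hu⟩)
  have hsum := sum_sum_exitFreq 𝔖 hEact
  have hsum0 : (𝔖.stateFreq (.mec E)).toNNReal ≠ 0 := fun h => by
    rcases (ENNReal.toNNReal_eq_zero_iff _).1 h with h | h
    exacts [hEact.2 h, stateFreq_quotient_ne_top 𝔖 _ h]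
  -- The exits of `E` carry its positive total frequency, so `𝔗` takes some exit, contrary to `hE`.
  obtain ⟨u, hu, hu'⟩ := Finset.exists_ne_zero_of_sum_ne_zero (hsum.trans_ne hsum0)
  obtain ⟨α, -, hα⟩ := Finset.exists_ne_zero_of_sum_ne_zero hu'
  have hu : u ∈ E.states := by simpa using hu
  refine hα (exitFreq_eq_zero_of_inMEC 𝔖 ⟨E, hE u hu α ?_⟩)
  exact hprob u α (hnotDead E hEact u hu) fun h => hα (add_eq_zero.1 h).2

end Scheduler
end MDP

theorem mainTheorem5 {S : Type*} {Act : Type*} [Fintype S] [Fintype Act] (M : MDP S Act)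
    (hM : M.DisjointActions) (𝔖 : (M.mecQuotient hM).MRScheduler)
    (hτ : ∀ E : M.MEC, 𝔖.prob (.mec E) MDP.tau = 0 ∨ 𝔖.prob (.mec E) MDP.tau = 1) :
    ∃ 𝔗 : M.MRScheduler, ∀ α : Act, (∀ (E : M.MEC) (s : S), (s, α) ∉ E.1) →
      𝔗.actionFreq α = 𝔖.actionFreq (some α) := by
  classical
  obtain ⟨𝔗, x, y, h1, h2, h3, h4⟩ := MDP.exists_scheduler 𝔖
  refine ⟨𝔗, fun α hα => ?_⟩
  have hw : ∀ s, M.mecWeight s α = 0 := fun s => by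
    by_contra h
    obtain ⟨E, hE⟩ := MDP.mecWeight_ne_zero.1 h
    exact hα E s hE
  have h5 : ∀ s, 𝔗.freq s α = MDP.exitFreq 𝔖 s α := by
    intro s
    rw [𝔗.freq_eq]
    -- At a dead state the state frequency may be `⊤`, but `α` has probability zero there and `⊤ * 0
    -- = 0`.
    by_cases hs : MDP.Dead 𝔖 s
    · rw [(h3 s hs).2, hw, MDP.exitFreq_eq_zero_of_dead 𝔖 hτ hs, ENNReal.coe_zero, mul_zero]
    · rw [MDP.stateFreq_eq_of_balance 𝔖 hτ h1 h2 h3 h4 hs, ← ENNReal.coe_mul, h1 s α hs, hw,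
        mul_zero, zero_add]
  simp only [MDP.MRScheduler.actionFreq, h5, 𝔖.freq_eq]
  rw [← Finset.sum_fiberwise (s := Finset.univ) (g := M.toQuot)]
  refine Finset.sum_congr rfl fun c _ => ?_
  rw [← ENNReal.ofNNReal_finsetSum, MDP.sum_exitFreq, ENNReal.coe_mul,
    ENNReal.coe_toNNReal (MDP.stateFreq_quotient_ne_top 𝔖 c)]
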